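/- Let $\Sigma=\{0,1,2\}^{\mathbb N_0}$ and let $\alpha\mapsto\alpha+1$ be addition of $100\dots$ mod $3$ with carry from left to right. For a rectangle $K=[a,b]\times[c,d]$ and $i\in\{0,1,2\}$ put $$K_i=\Big[a+\tfrac{2i(b-a)}5,\;a+\tfrac{(2i+1)(b-a)}5\Big]\times[c,\;c+\theta_i(d-c)],\qquad \theta_1=1,\ \theta_0=\theta_2=\tfrac13 .$$ Put $K_\emptyset=[0,1]^2$, $K_{wi}=(K_w)_i$ for finite words $w$ over $\{0,1,2\}$, and $X=\bigcap_{n\ge0}\bigcup_{|w|=n}K_w$. For $\alpha\in\Sigma$ let $x_\alpha=\sum_{i\ge0}2\alpha_i/5^{i+1}$, let $\ell_\alpha\in\{0,1,\dots,\infty\}$ be the number of $i$ with $\alpha_i\in\{0,2\}$, and let $J_\alpha=[0,3^{-\ell_\alpha}]$ (with $3^{-\infty}=0$). Then $X=\bigcup_{\alpha\in\Sigma}\{x_\alpha\}\times J_\alpha$, and there is a homeomorphism $H\colon X\to X$ with $$H(x_\alpha,y)=(x_{\alpha+1},\,3^{\ell_\alpha-\ell_{\alpha+1}}y)\qquad(\alpha\in\Sigma,\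 y\in J_\alpha),$$ where the second coordinate is $0$ if $\ell_\alpha=\infty$. Let $C_1=\{x_\alpha:\alpha\in\Sigma\}$, let $C_2$ be the ternary Cantor set, and let $Y=X\cap(C_1\times C_2)$. Then $H(Y)=Y$, the set $Y$ is a Cantor set (homeomorphic to $C_2$), and the homeomorphism $G=H|_Y\colon Y\to Y$ is Li–Yorke chaotic but not Li–Yorke $\varepsilon$-chaotic for any $\varepsilon>0$. In particular, there is a homeomorphism of a Cantor set which is Li–Yorke chaotic but not Li–Yorke $\varepsilon$-chaotic for any $\varepsilon>0$. Here, for a continuous selfmap $f$ of a compact metric space $(Z,d)$, a pair $(x,y)$ is scrambled (respectively $\varepsilon$-scrambled) if $\liminf_{n\to\infty} d(f^n(x),f^n(y))=0$ and $\limsup_{n\to\infty} d(f^n(x),f^n(y))>0$ (respectively $>\varepsilon$). A set is scrambled ($\varepsilon$-scrambled) if all pairs of its distinct points are, and $f$ is Li–Yorke chaotic (Li–Yorke $\varepsilon$-chaotic) if it has an uncountable scrambled ($\varepsilon$-scrambled) set. The plane carries the maximum metric. -/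

import Mathlib

open Set Filter Topology

noncomputable section

namespace LiYorke

section Chaos

variable {X : Type*} [MetricSpace X]

/-- The proximal relation of `f`. In a compact (or just bounded) space the sequence of distances is
bounded, so this `liminf` and the `limsup`s below are the genuine ones. -/
def Prox (f : X → X) : Set (X × X) :=
  {p | liminf (fun n : ℕ => dist (f^[n] p.1) (f^[n] p.2)) atTop = 0}

/-- The complement of the asymptotic relation of `f`. -/
def nAs (f : X → X) : Set (X × X) :=
  {p | 0 < limsup (fun n : ℕ => dist (f^[n] p.1) (f^[n] p.2)) atTop}

def nAsEps (f : X → X) (ε : ℝ) : Set (X × X) :=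
  {p | ε < limsup (fun n : ℕ => dist (f^[n] p.1) (f^[n] p.2)) atTop}

/-- The set of scrambled (Li-Yorke) pairs. -/
def LY (f : X → X) : Set (X × X) := Prox f ∩ nAs f

/-- The set of `ε`-scrambled pairs. -/
def LYEps (f : X → X) (ε : ℝ) : Set (X × X) := Prox f ∩ nAsEps f ε

def IsScrambled (f : X → X) (S : Set X) : Prop :=
  ∀ x ∈ S, ∀ y ∈ S, x ≠ y → (x, y) ∈ LY f

def IsEpsScrambled (f : X → X) (ε : ℝ) (S : Set X) : Prop :=
  ∀ x ∈ S, ∀ y ∈ S, x ≠ y → (x, y) ∈ LYEps f ε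

def LiYorkeChaotic (f : X → X) : Prop :=
  ∃ S : Set X, ¬ S.Countable ∧ IsScrambled f S

def LiYorkeEpsChaotic (f : X → X) (ε : ℝ) : Prop :=
  ∃ S : Set X, ¬ S.Countable ∧ IsEpsScrambled f ε S

end Chaos

/-- A Cantor set: a space homeomorphic to the ternary Cantor set. -/
def IsCantor (X : Type*) [TopologicalSpace X] : Prop := Nonempty (X ≃ₜ cantorSet)

/-- The data `(a, b, c, d)` of the rectangle `[a, b] × [c, d]`. -/
structure Rect where
  a : ℝ
  b : ℝ
  c : ℝ
  d : ℝ

def Rect.toSet (K : Rect) : Set (ℝ × ℝ) := Icc K.a K.b ×ˢ Icc K.c K.d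

def theta (i : Fin 3) : ℝ := if i = 1 then 1 else 1 / 3

/-- The subrectangle `K_i` of `K`. -/
def Rect.sub (K : Rect) (i : Fin 3) : Rect where
  a := K.a + 2 * ((i : ℕ) : ℝ) * (K.b - K.a) / 5
  b := K.a + (2 * ((i : ℕ) : ℝ) + 1) * (K.b - K.a) / 5
  c := K.c
  d := K.c + theta i * (K.d - K.c)

/-- The rectangle `K_w` of a finite word `w`: `K_∅ = [0, 1] × [0, 1]` and `K_{wi} = (K_w)_i`. -/
def wordRect (w : List (Fin 3)) : Rect := w.foldl Rect.sub ⟨0, 1, 0, 1⟩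

def level (n : ℕ) : Set (ℝ × ℝ) :=
  {p | ∃ w : List (Fin 3), w.length = n ∧ p ∈ (wordRect w).toSet}

/-- The nested-rectangle set `X` in the unit square. -/
def nestedSet : Set (ℝ × ℝ) := ⋂ n : ℕ, level n

/-- `α ↦ α + 1 = α + 10^∞`: addition mod 3 with carry from left to right; the carry reaches position
`i` exactly when all earlier digits are `2`. -/
def addOne (α : ℕ → Fin 3) : ℕ → Fin 3 := fun i => if ∀ j < i, α j = 2 then α i + 1 else α i

/-- The abscissa `x_α`. -/
def xCoord (α : ℕ → Fin 3) : ℝ := ∑' i : ℕ, 2 * ((α i : ℕ) : ℝ) / 5 ^ (i + 1)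

/-- `ℓ_α`, the number (possibly infinite) of digits of `α` in `{0, 2}`. -/
def ell (α : ℕ → Fin 3) : ℕ∞ := {i : ℕ | α i = 0 ∨ α i = 2}.encard

/-- `3 ^ (-ℓ_α)`, which is `0` if `ℓ_α` is infinite. -/
def height (α : ℕ → Fin 3) : ℝ := if ell α = ⊤ then 0 else ((3 : ℝ) ^ (ell α).toNat)⁻¹

/-- The vertical fibre `K_α = {x_α} × J_α` with `J_α = [0, 3 ^ (-ℓ_α)]`. -/
def fibre (α : ℕ → Fin 3) : Set (ℝ × ℝ) := {xCoord α} ×ˢ Icc 0 (height α)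

/-- The fibre map `h_α(y) = 3 ^ (ℓ_α - ℓ_{α+1}) y`. If `ℓ_α` is infinite, so is `ℓ_{α+1}`, and both
fibres consist of one point, with `y = 0`; the value of the factor is then irrelevant. -/
def fibreMap (α : ℕ → Fin 3) (y : ℝ) : ℝ :=
  (3 : ℝ) ^ (((ell α).toNat : ℤ) - ((ell (addOne α)).toNat : ℤ)) * y

/-- The set `Y = X ∩ (C₁ × C₂)`, as a subset of `X`, where `C₁ = {x_α}` and `C₂` is the ternary
Cantor set. -/
def cantorPart : Set nestedSet := {p | (p : ℝ × ℝ) ∈ range xCoord ×ˢ cantorSet}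

end LiYorke

end

/-!
Points of `X` are pairs `(x_α, y)` with `0 ≤ y ≤ 3 ^ (-ℓ_α)`, and `H` is a skew product over the
odometer `α ↦ α + 1`. That every point of `X` lies in a fibre follows from compactness of the space
of sequences (`nestedSet_eq_iUnion_fibre`). If the first digit of `α` different from `2` is a `0`,
then `ℓ_α = ℓ_{α+1} + 1` and `H` multiplies ordinates by `3`; if it is a `1`, then
`ℓ_{α+1} = ℓ_α + 1` and `H` divides them by `3`; the fibres over `2^∞` and `0^∞` are points. Hence
the factor is locally constant off `2^∞`, and as it is at most `3`, while ordinates tend to `0` at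
the fibre over `2^∞`, `H` is continuous (`continuous_stepMap`). It is bijective because the odometer
and the fibre maps are, and `X` is compact.

The ternary Cantor set `C₂` satisfies `C₂ ∩ [0, 1/3] = C₂ / 3`, so multiplying or dividing by `3`
within the fibres preserves `Y`. The space `Y` is compact, totally disconnected and has no isolated
points, so it is a Cantor set by Brouwer's theorem (`nonempty_homeomorph_nat_bool`).

The fibre of `Y` over `1^∞` is a copy of `C₂`, and it is scrambled: the sequences
`1^∞ + (3 ^ k - 1) / 2 = 2^k 1^∞` and `1^∞ + 3 ^ k = 1^k 2 1^∞` have `k` digits, respectively one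
digit, different from `1`, so that the distance of two points of the fibre is divided by `3 ^ k` and
by `3` at these times (`mem_LY_of_fibre_ones`). On the other hand, the odometer preserves the
position of the first difference of two sequences, so proximal points lie in the same fibre
(`digits_eq_of_mem_Prox`). Distances in the fibre over `α` never grow by a factor larger than
`3 ^ ℓ_α`, so an `ε`-scrambled set is uniformly separated, hence countable.
-/

open Set Filter Topology

noncomputable section

namespace LiYorke

/-! ### Brouwer's characterization of the Cantor space -/

section Cantor

variable {Z : Type*}

/-- In a zero-dimensional space without isolated points, a nonempty clopen set `U` can be cut into
two nonempty clopen pieces, along a prescribed clopen set `B` whenever `B` cuts `U` properly. -/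
lemma exists_clopen_split [TopologicalSpace Z] [CompactSpace Z] [T2Space Z]
    [TotallyDisconnectedSpace Z]
    (hperf : ∀ z : Z, (𝓝[≠] z).NeBot) {U B : Set Z} (hU : IsClopen U) (hne : U.Nonempty)
    (hB : IsClopen B) :
    ∃ V, IsClopen V ∧ V ⊆ U ∧ V.Nonempty ∧ (U \ V).Nonempty ∧
      ((U ∩ B).Nonempty → (U \ B).Nonempty → V = U ∩ B) := by
  by_cases h : (U ∩ B).Nonempty ∧ (U \ B).Nonempty
  · exact ⟨U ∩ B, hU.inter hB, inter_subset_left, h.1, by rw [sdiff_self_inter]; exact h.2,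
      fun _ _ => rfl⟩
  obtain ⟨z, hz⟩ := hne
  obtain ⟨w, hwU, hwz⟩ : ∃ w ∈ U, w ≠ z := by
    have h1 : U ∈ 𝓝[≠] z := mem_nhdsWithin_of_mem_nhds (hU.isOpen.mem_nhds hz)
    have := hperf z
    obtain ⟨w, hw⟩ := Filter.nonempty_of_mem (Filter.inter_mem h1 self_mem_nhdsWithin)
    exact ⟨w, hw.1, hw.2⟩
  obtain ⟨V, hV, hzV, hVU⟩ := compact_exists_isClopen_in_isOpen
    (hU.isOpen.inter (isOpen_compl_singleton (x := w))) (show z ∈ U ∩ {w}ᶜ from ⟨hz, hwz.symm⟩)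
  exact ⟨V, hV, fun x hx => (hVU hx).1, ⟨z, hzV⟩, ⟨w, hwU, fun hw => (hVU hw).2 rfl⟩,
    fun h1 h2 => absurd ⟨h1, h2⟩ h⟩

/-- The cell containing `z` of the `n`-th partition, where `V U B` is the piece that is cut off from
the cell `U` by means of the set `B`, and `B n` is used at stage `n`. -/
def cell (V : Set Z → Set Z → Set Z) (B : ℕ → Set Z) : ℕ → Z → Set Z
  | 0, _ => univ
  | n + 1, z => {w ∈ cell V B n z | w ∈ V (cell V B n z) (B n) ↔ z ∈ V (cell V B n z) (B n)}

/-- The itinerary of `z` through the successive partitions into cells. -/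
def itinerary (V : Set Z → Set Z → Set Z) (B : ℕ → Set Z) (z : Z) (n : ℕ) : Bool :=
  open Classical in decide (z ∈ V (cell V B n z) (B n))

lemma mem_cell_self (V : Set Z → Set Z → Set Z) (B : ℕ → Set Z) (n : ℕ) (z : Z) :
    z ∈ cell V B n z := by
  induction n with
  | zero => trivial
  | succ n ih => exact ⟨ih, Iff.rfl⟩

lemma cell_eq_of_mem (V : Set Z → Set Z → Set Z) (B : ℕ → Set Z) (n : ℕ) {z w : Z}
    (h : w ∈ cell V B n z) :
    cell V B n w = cell V B n z ∧ ∀ i < n, itinerary V B w i = itinerary V B z i := by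
  induction n with
  | zero => exact ⟨rfl, by simp⟩
  | succ n ih =>
    obtain ⟨h1, h2⟩ := ih h.1
    have h3 := h.2
    refine ⟨by simp only [cell, h1, h3], fun i hi => ?_⟩
    rcases Nat.lt_succ_iff_lt_or_eq.1 hi with hi | rfl
    · exact h2 i hi
    · exact decide_eq_decide.2 (by rw [h1]; exact h3)

lemma cell_eq_of_itinerary_eq (V : Set Z → Set Z → Set Z) (B : ℕ → Set Z) (n : ℕ) {z w : Z}
    (h : ∀ i < n, itinerary V B w i = itinerary V B z i) : cell V B n w = cell V B n z := by
  induction n with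
  | zero => rfl
  | succ n ih =>
    have h1 := ih fun i hi => h i (hi.trans n.lt_succ_self)
    have h2 := h n n.lt_succ_self
    simp only [itinerary, h1, decide_eq_decide] at h2
    simp only [cell, h1, h2]

/-- Brouwer's characterization of the Cantor space. Cells are refined along an enumeration of the
clopen sets, so that an itinerary determines its point; cells are nonempty and compact, so that
every itinerary occurs. -/
theorem nonempty_homeomorph_nat_bool [TopologicalSpace Z] [CompactSpace Z] [T2Space Z]
    [TotallyDisconnectedSpace Z] [SecondCountableTopology Z] [Nonempty Z]
    (hperf : ∀ z : Z, (𝓝[≠] z).NeBot) :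
    Nonempty (Z ≃ₜ (ℕ → Bool)) := by
  have : Countable (TopologicalSpace.Clopens Z) :=
    TopologicalSpace.Clopens.countable_iff_secondCountable.2 inferInstance
  obtain ⟨b, hb⟩ := exists_surjective_nat (TopologicalSpace.Clopens Z)
  set B : ℕ → Set Z := fun n => b n with hBdef
  have hB : ∀ n, IsClopen (B n) := fun n => (b n).isClopen
  have hsplit : ∀ U C : Set Z, ∃ V, IsClopen U → U.Nonempty → IsClopen C →
      IsClopen V ∧ V ⊆ U ∧ V.Nonempty ∧ (U \ V).Nonempty ∧
      ((U ∩ C).Nonempty → (U \ C).Nonempty → V = U ∩ C) := by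
    intro U C
    by_cases h : IsClopen U ∧ U.Nonempty ∧ IsClopen C
    · obtain ⟨V, hV⟩ := exists_clopen_split hperf h.1 h.2.1 h.2.2
      exact ⟨V, fun _ _ _ => hV⟩
    · exact ⟨∅, fun h1 h2 h3 => absurd ⟨h1, h2, h3⟩ h⟩
  choose V hV using hsplit
  have hclopen : ∀ n z, IsClopen (cell V B n z) := by
    intro n z
    induction n with
    | zero => exact isClopen_univ
    | succ n ih =>
      have hVc := (hV _ _ ih ⟨z, mem_cell_self V B n z⟩ (hB n)).1
      by_cases hz : z ∈ V (cell V B n z) (B n)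
      · have : cell V B (n + 1) z = cell V B n z ∩ V (cell V B n z) (B n) := by
          ext w; simp [cell, hz]
        rw [this]; exact ih.inter hVc
      · have : cell V B (n + 1) z = cell V B n z \ V (cell V B n z) (B n) := by
          ext w; simp [cell, hz]
        rw [this]; exact ih.diff hVc
  have hP := fun n z => hV _ _ (hclopen n z) ⟨z, mem_cell_self V B n z⟩ (hB n)
  have hcont : Continuous (itinerary V B) := by
    refine continuous_pi fun n =>
      ((IsLocallyConstant.iff_exists_open _).2 fun z => ?_).continuous
    exact ⟨cell V B (n + 1) z, (hclopen _ z).isOpen, mem_cell_self _ _ _ z,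
      fun w hw => (cell_eq_of_mem V B (n + 1) hw).2 n n.lt_succ_self⟩
  have hinj : Function.Injective (itinerary V B) := by
    intro z w hzw
    by_contra hne
    -- the stage at which a clopen set separating `z` from `w` is used puts them in different pieces
    obtain ⟨C, hC, hzC, hCw⟩ := compact_exists_isClopen_in_isOpen
      (isOpen_compl_singleton (x := w)) (show z ∈ ({w}ᶜ : Set Z) from hne)
    have hwC : w ∉ C := fun h => hCw h rfl
    obtain ⟨n, hn⟩ := hb ⟨C, hC⟩
    have hBn : B n = C := by simp [hBdef, hn]
    have hcell := cell_eq_of_itinerary_eq V B n (z := z) (w := w) fun i _ => (congrFun hzw i).symm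
    have hw : w ∈ cell V B n z := hcell ▸ mem_cell_self V B n w
    have hVn := (hP n z).2.2.2.2 ⟨z, mem_cell_self V B n z, hBn ▸ hzC⟩ ⟨w, hw, hBn ▸ hwC⟩
    have h2 := congrFun hzw n
    simp only [itinerary, hcell, decide_eq_decide] at h2
    rw [hVn, hBn] at h2
    exact hwC (h2.1 ⟨mem_cell_self V B n z, hzC⟩).2
  have hsurj : Function.Surjective (itinerary V B) := by
    intro c
    set D : ℕ → Set Z := fun n => {z | ∀ i < n, itinerary V B z i = c i} with hD
    have hDne : ∀ n, (D n).Nonempty := by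
      intro n
      induction n with
      | zero => exact ⟨Classical.arbitrary Z, by simp [hD]⟩
      | succ n ih =>
        obtain ⟨z, hz⟩ := ih
        obtain ⟨w, hw, hwc⟩ : ∃ w ∈ cell V B n z, itinerary V B w n = c n := by
          obtain ⟨-, hsub, ⟨u, hu⟩, ⟨v, hv⟩, -⟩ := hP n z
          cases hc : c n with
          | true =>
            refine ⟨u, hsub hu, ?_⟩
            simpa [itinerary, (cell_eq_of_mem V B n (hsub hu)).1] using hu
          | false =>
            refine ⟨v, hv.1, ?_⟩
            simpa [itinerary, (cell_eq_of_mem V B n hv.1).1] using hv.2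
        refine ⟨w, fun i hi => ?_⟩
        rcases Nat.lt_succ_iff_lt_or_eq.1 hi with hi | rfl
        · rw [(cell_eq_of_mem V B n hw).2 i hi, hz i hi]
        · exact hwc
    have hDcl : ∀ n, IsClosed (D n) := by
      intro n
      simp only [hD, Set.ofPred_forall]
      exact isClosed_iInter fun i => isClosed_iInter fun _ =>
        isClosed_eq ((continuous_apply i).comp hcont) continuous_const
    obtain ⟨z, hz⟩ := IsCompact.nonempty_iInter_of_sequence_nonempty_isCompact_isClosed D
      (fun n z hz i hi => hz i (hi.trans n.lt_succ_self)) hDne (hDcl 0).isCompact hDcl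
    exact ⟨z, funext fun i => mem_iInter.1 hz (i + 1) i i.lt_succ_self⟩
  exact ⟨hcont.homeoOfEquivCompactToT2 (f := Equiv.ofBijective _ ⟨hinj, hsurj⟩)⟩

end Cantor

/-! ### The abscissas `x_α` -/

lemma summable_xCoord (α : ℕ → Fin 3) :
    Summable fun i : ℕ => 2 * ((α i : ℕ) : ℝ) / 5 ^ (i + 1) := by
  refine Summable.of_nonneg_of_le (fun i => by positivity) (fun i => ?_)
    ((summable_geometric_of_lt_one (r := (1 / 5 : ℝ)) (by norm_num) (by norm_num)).mul_left 1)
  have h : ((α i : ℕ) : ℝ) ≤ 2 := by exact_mod_cast (by omega : (α i : ℕ) ≤ 2)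
  rw [one_mul, one_div, inv_pow, ← one_div, div_le_div_iff₀ (by positivity) (by positivity),
    pow_succ]
  nlinarith [pow_pos (show (0 : ℝ) < 5 by norm_num) i]

/-- The self-similarity of `C₁`: `x_α` is read off from the first digit and the shifted sequence. -/
lemma xCoord_eq (α : ℕ → Fin 3) :
    xCoord α = 2 * ((α 0 : ℕ) : ℝ) / 5 + xCoord (fun i => α (i + 1)) / 5 := by
  rw [xCoord, (summable_xCoord α).tsum_eq_zero_add, xCoord, ← tsum_div_const]
  congr 1
  · simp
  · refine tsum_congr fun i => ?_
    rw [div_div, pow_succ 5 (i + 1)]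

lemma xCoord_nonneg (α : ℕ → Fin 3) : 0 ≤ xCoord α := tsum_nonneg fun i => by positivity

lemma xCoord_le_one (α : ℕ → Fin 3) : xCoord α ≤ 1 := by
  have hg := (hasSum_geometric_of_lt_one (r := (1 / 5 : ℝ)) (by norm_num) (by norm_num)).mul_left
    (4 / 5)
  have : xCoord α ≤ 4 / 5 * (1 - 1 / 5)⁻¹ := by
    rw [← hg.tsum_eq]
    refine (summable_xCoord α).tsum_le_tsum (fun i => ?_) hg.summable
    have h : ((α i : ℕ) : ℝ) ≤ 2 := by exact_mod_cast (by omega : (α i : ℕ) ≤ 2)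
    rw [one_div, inv_pow, pow_succ, div_le_iff₀ (by positivity)]
    field_simp
    linarith
  norm_num at this
  exact this

/-- Two sequences whose first difference is at position `m` have abscissas at distance at least
`5 ^ (-(m + 1))`. -/
lemma le_abs_xCoord_sub {m : ℕ} {α β : ℕ → Fin 3} (h : ∀ i < m, α i = β i) (hm : α m ≠ β m) :
    (1 / 5 : ℝ) ^ (m + 1) ≤ |xCoord α - xCoord β| := by
  induction m generalizing α β with
  | zero =>
    have h0 := xCoord_nonneg fun i => α (i + 1)
    have h1 := xCoord_le_one fun i => α (i + 1)
    have h2 := xCoord_nonneg fun i => β (i + 1)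
    have h3 := xCoord_le_one fun i => β (i + 1)
    rw [xCoord_eq α, xCoord_eq β]
    rcases lt_or_gt_of_ne (fun h => hm (Fin.ext h) : (α 0 : ℕ) ≠ β 0) with hlt | hlt
    · have : ((α 0 : ℕ) : ℝ) + 1 ≤ (β 0 : ℕ) := by exact_mod_cast hlt
      exact le_abs.2 (Or.inr (by linarith))
    · have : ((β 0 : ℕ) : ℝ) + 1 ≤ (α 0 : ℕ) := by exact_mod_cast hlt
      exact le_abs.2 (Or.inl (by linarith))
  | succ m ih =>
    have h' := ih (α := fun i => α (i + 1)) (β := fun i => β (i + 1))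
      (fun i hi => h (i + 1) (by omega)) hm
    rw [xCoord_eq α, xCoord_eq β, h 0 (by omega), pow_succ, add_sub_add_left_eq_sub, ← sub_div,
      abs_div, abs_of_pos (show (0 : ℝ) < 5 by norm_num)]
    linarith

lemma exists_first_difference {α β : ℕ → Fin 3} (h : α ≠ β) :
    ∃ m, (∀ i < m, α i = β i) ∧ α m ≠ β m := by
  classical
  have hex : ∃ m, α m ≠ β m := Function.ne_iff.1 h
  exact ⟨Nat.find hex, fun i hi => not_not.1 (Nat.find_min hex hi), Nat.find_spec hex⟩

lemma xCoord_injective : Function.Injective xCoord := by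
  intro α β h
  by_contra hne
  obtain ⟨m, hm, hm'⟩ := exists_first_difference hne
  have := le_abs_xCoord_sub hm hm'
  rw [h, sub_self, abs_zero] at this
  exact absurd this (not_le.2 (by positivity))

lemma continuous_xCoord : Continuous xCoord := by
  refine continuous_tsum (u := fun i => 4 / 5 * (1 / 5 : ℝ) ^ i) (fun i => ?_)
    ((summable_geometric_of_lt_one (by norm_num) (by norm_num)).mul_left _) (fun i α => ?_)
  · have : Continuous fun d : Fin 3 => 2 * ((d : ℕ) : ℝ) / 5 ^ (i + 1) :=
      continuous_of_discreteTopology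
    exact this.comp (continuous_apply i)
  · have h : ((α i : ℕ) : ℝ) ≤ 2 := by exact_mod_cast (by omega : (α i : ℕ) ≤ 2)
    rw [Real.norm_of_nonneg (by positivity), one_div, inv_pow, pow_succ,
      div_le_iff₀ (by positivity)]
    field_simp
    linarith

lemma isClosedEmbedding_xCoord : IsClosedEmbedding xCoord :=
  continuous_xCoord.isClosedEmbedding xCoord_injective

/-! ### The odometer on sequences -/

lemma addOne_agree {m : ℕ} {α β : ℕ → Fin 3} (h : ∀ i < m, α i = β i) :
    ∀ i < m, addOne α i = addOne β i := by
  intro i hi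
  have : (∀ j < i, α j = 2) ↔ ∀ j < i, β j = 2 :=
    forall₂_congr fun j hj => by rw [h j (hj.trans hi)]
  simp only [addOne, this, h i hi]

lemma addOne_differ {m : ℕ} {α β : ℕ → Fin 3} (h : ∀ i < m, α i = β i) (hm : α m ≠ β m) :
    addOne α m ≠ addOne β m := by
  have : (∀ j < m, α j = 2) ↔ ∀ j < m, β j = 2 := forall₂_congr fun j hj => by rw [h j hj]
  simp only [addOne, this]
  split_ifs
  · simpa using hm
  · exact hm

lemma addOne_injective : Function.Injective addOne := by
  intro α β h
  by_contra hne
  obtain ⟨m, hm, hm'⟩ := exists_first_difference hne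
  exact addOne_differ hm hm' (congrFun h m)

lemma addOne_surjective : Function.Surjective addOne := by
  intro β
  -- subtraction of one, with borrow from left to right
  set α : ℕ → Fin 3 := fun i => if ∀ j < i, β j = 0 then β i - 1 else β i with hα
  have key : ∀ n, (∀ j < n, β j = 0) ↔ ∀ j < n, α j = 2 := by
    intro n
    induction n with
    | zero => simp
    | succ n ih =>
      rw [Nat.forall_lt_succ_right, Nat.forall_lt_succ_right, ← ih]
      refine and_congr_right fun hn => ?_
      simp only [hα, if_pos hn]
      generalize β n = d
      revert d
      decide
  refine ⟨α, funext fun i => ?_⟩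
  by_cases h : ∀ j < i, β j = 0
  · rw [addOne, if_pos ((key i).1 h)]
    simp [hα, if_pos h]
  · rw [addOne, if_neg (fun h' => h ((key i).2 h'))]
    simp [hα, if_neg h]

lemma addOne_iterate_agree {m : ℕ} {α β : ℕ → Fin 3} (h : ∀ i < m, α i = β i) (n : ℕ) :
    ∀ i < m, addOne^[n] α i = addOne^[n] β i := by
  induction n with
  | zero => exact h
  | succ n ih => simp only [Function.iterate_succ_apply']; exact addOne_agree ih

/-- The odometer preserves the position of the first difference of two sequences. -/
lemma addOne_iterate_differ {m : ℕ} {α β : ℕ → Fin 3} (h : ∀ i < m, α i = β i) (hm : α m ≠ β m)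
    (n : ℕ) : addOne^[n] α m ≠ addOne^[n] β m := by
  induction n with
  | zero => exact hm
  | succ n ih =>
    simp only [Function.iterate_succ_apply']
    exact addOne_differ (addOne_iterate_agree h n) ih

lemma isOpen_setOf_agree (n : ℕ) (α : ℕ → Fin 3) :
    IsOpen {β : ℕ → Fin 3 | ∀ j < n, β j = α j} := by
  have h := isOpen_set_pi (s := fun j => ({α j} : Set (Fin 3))) (finite_lt_nat n)
    fun j _ => isOpen_discrete _
  convert h using 1
  ext β
  simp

lemma continuous_addOne : Continuous addOne := by
  refine continuous_pi fun i => ((IsLocallyConstant.iff_exists_open _).2 fun α => ?_).continuous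
  exact ⟨_, isOpen_setOf_agree (i + 1) α, fun _ _ => rfl, fun β hβ =>
    addOne_agree hβ i i.lt_succ_self⟩

/-! ### The heights of the fibres -/

lemma height_nonneg (α : ℕ → Fin 3) : 0 ≤ height α := by
  unfold height; split_ifs <;> positivity

/-- The height of the rectangle `K_w` for the prefix `w` of length `n` of `α`. -/
def prefixHeight (α : ℕ → Fin 3) (n : ℕ) : ℝ := ∏ i ∈ Finset.range n, theta (α i)

lemma theta_eq (d : Fin 3) : theta d = if d = 0 ∨ d = 2 then 1 / 3 else 1 := by
  fin_cases d <;> simp [theta]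

lemma prefixHeight_eq (α : ℕ → Fin 3) (n : ℕ) :
    prefixHeight α n = (1 / 3) ^ ((Finset.range n).filter fun i => α i = 0 ∨ α i = 2).card := by
  simp only [prefixHeight, theta_eq, Finset.prod_ite, Finset.prod_const, one_pow, mul_one]

/-- `3 ^ (-ℓ_α)` is the infimum of the heights of the rectangles along `α`. -/
lemma le_height_iff (α : ℕ → Fin 3) (y : ℝ) : y ≤ height α ↔ ∀ n, y ≤ prefixHeight α n := by
  simp only [prefixHeight_eq]
  by_cases hfin : {i : ℕ | α i = 0 ∨ α i = 2}.Finite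
  · have hell : ell α = (hfin.toFinset.card : ℕ∞) := hfin.encard_eq_coe_toFinset_card
    rw [height, hell, if_neg (ENat.natCast_ne_top _), ENat.toNat_natCast, ← inv_pow, ← one_div]
    constructor
    · refine fun h n => h.trans ?_
      refine pow_le_pow_of_le_one (by norm_num) (by norm_num) (Finset.card_le_card fun i hi => ?_)
      simpa using (Finset.mem_filter.1 hi).2
    · intro h
      obtain ⟨N, hN⟩ := hfin.toFinset.exists_nat_subset_range
      refine (h N).trans (pow_le_pow_of_le_one (by norm_num) (by norm_num)
        (Finset.card_le_card fun i hi => ?_))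
      exact Finset.mem_filter.2 ⟨hN hi, by simpa using hi⟩
  · have hell : ell α = ⊤ := Set.encard_eq_top hfin
    rw [height, if_pos hell]
    refine ⟨fun h n => h.trans (by positivity), fun h => ?_⟩
    refine ge_of_tendsto' (tendsto_pow_atTop_nhds_zero_of_lt_one (r := (1 / 3 : ℝ)) (by norm_num)
      (by norm_num)) fun k => ?_
    obtain ⟨t, ht, htk⟩ := Set.Infinite.exists_subset_card_eq hfin k
    obtain ⟨N, hN⟩ := t.exists_nat_subset_range
    refine (h N).trans (pow_le_pow_of_le_one (by norm_num) (by norm_num) ?_)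
    rw [← htk]
    exact Finset.card_le_card fun i hi => Finset.mem_filter.2 ⟨hN hi, ht hi⟩

lemma height_le_one (α : ℕ → Fin 3) : height α ≤ 1 := by
  simpa [prefixHeight] using (le_height_iff α _).1 le_rfl 0

/-! ### Decomposition of `X` into fibres -/

/-- The partial sum of `x_α`, the left end of the rectangle of the prefix of length `n`. -/
def prefixSum (α : ℕ → Fin 3) (n : ℕ) : ℝ :=
  ∑ i ∈ Finset.range n, 2 * ((α i : ℕ) : ℝ) / 5 ^ (i + 1)

lemma wordRect_map_range (α : ℕ → Fin 3) (n : ℕ) :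
    wordRect ((List.range n).map α) =
      ⟨prefixSum α n, prefixSum α n + (1 / 5) ^ n, 0, prefixHeight α n⟩ := by
  induction n with
  | zero => simp [wordRect, prefixSum, prefixHeight]
  | succ n ih =>
    unfold wordRect at ih ⊢
    rw [List.range_succ, List.map_append, List.foldl_append, ih]
    simp only [List.map_cons, List.map_nil, List.foldl_cons, List.foldl_nil, Rect.sub, prefixSum,
      prefixHeight, Finset.sum_range_succ, Finset.prod_range_succ, Rect.mk.injEq, one_div, inv_pow]
    refine ⟨?_, ?_, trivial, ?_⟩ <;> field_simp <;> ring

/-- The rectangle of the prefix of length `n` of `α`. -/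
def prefixRect (α : ℕ → Fin 3) (n : ℕ) : Set (ℝ × ℝ) :=
  Icc (prefixSum α n) (prefixSum α n + (1 / 5) ^ n) ×ˢ Icc 0 (prefixHeight α n)

lemma mem_level_iff (n : ℕ) (p : ℝ × ℝ) : p ∈ level n ↔ ∃ α, p ∈ prefixRect α n := by
  constructor
  · rintro ⟨w, rfl, hp⟩
    refine ⟨fun i => w.getD i 0, ?_⟩
    have hw : (List.range w.length).map (fun i => w.getD i 0) = w := by
      refine List.ext_getElem (by simp) fun i h1 h2 => ?_
      simp [h2]
    rw [← hw, wordRect_map_range] at hp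
    simpa [prefixRect, Rect.toSet] using hp
  · rintro ⟨α, hp⟩
    exact ⟨(List.range n).map α, by simp, by rw [wordRect_map_range]; exact hp⟩

lemma prefixHeight_succ_le (α : ℕ → Fin 3) (n : ℕ) :
    prefixHeight α (n + 1) ≤ prefixHeight α n := by
  rw [prefixHeight_eq, prefixHeight_eq]
  refine pow_le_pow_of_le_one (by norm_num) (by norm_num) (Finset.card_le_card ?_)
  exact Finset.filter_subset_filter _ (Finset.range_subset_range.2 n.le_succ)

lemma prefixRect_succ_subset (α : ℕ → Fin 3) (n : ℕ) :
    prefixRect α (n + 1) ⊆ prefixRect α n := by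
  rintro p ⟨⟨h1, h2⟩, h3, h4⟩
  have h : ((α n : ℕ) : ℝ) ≤ 2 := by exact_mod_cast (by omega : (α n : ℕ) ≤ 2)
  have hs : prefixSum α (n + 1) = prefixSum α n + 2 * ((α n : ℕ) : ℝ) / 5 * (1 / 5) ^ n := by
    rw [prefixSum, Finset.sum_range_succ, prefixSum, pow_succ, one_div, inv_pow]
    field_simp
  rw [hs] at h1 h2
  rw [pow_succ] at h2
  have hp : (0 : ℝ) < (1 / 5) ^ n := by positivity
  refine ⟨⟨le_trans ?_ h1, h2.trans ?_⟩, h3, h4.trans (prefixHeight_succ_le α n)⟩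
  · have : (0 : ℝ) ≤ 2 * ((α n : ℕ) : ℝ) / 5 * (1 / 5) ^ n := by positivity
    linarith
  · nlinarith

lemma xCoord_eq_prefixSum_add (α : ℕ → Fin 3) (n : ℕ) :
    xCoord α = prefixSum α n + (1 / 5) ^ n * xCoord (fun i => α (i + n)) := by
  induction n with
  | zero => simp [prefixSum]
  | succ n ih =>
    have hs : prefixSum α (n + 1) = prefixSum α n + 2 * ((α n : ℕ) : ℝ) / 5 ^ (n + 1) :=
      Finset.sum_range_succ _ _
    rw [ih, xCoord_eq (fun i => α (i + n)), hs]
    simp only [zero_add, add_right_comm _ 1 n, one_div, inv_pow, pow_succ, add_assoc]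
    field_simp

lemma fibre_eq_iInter (α : ℕ → Fin 3) : fibre α = ⋂ n, prefixRect α n := by
  ext ⟨x, y⟩
  simp only [fibre, prefixRect, mem_prod, mem_singleton_iff, mem_Icc, mem_iInter, le_height_iff]
  constructor
  · rintro ⟨rfl, h0, h⟩ n
    have hp : (0 : ℝ) < (1 / 5) ^ n := by positivity
    have h1 := xCoord_nonneg fun i => α (i + n)
    have h2 := xCoord_le_one fun i => α (i + n)
    rw [xCoord_eq_prefixSum_add α n]
    exact ⟨⟨by nlinarith, by nlinarith⟩, h0, h n⟩
  · intro h
    refine ⟨?_, (h 0).2.1, fun n => (h n).2.2⟩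
    have hS : Tendsto (prefixSum α) atTop (𝓝 (xCoord α)) :=
      (summable_xCoord α).hasSum.tendsto_sum_nat
    have hT := hS.add (tendsto_pow_atTop_nhds_zero_of_lt_one (r := (1 / 5 : ℝ)) (by norm_num)
      (by norm_num))
    rw [add_zero] at hT
    exact le_antisymm (ge_of_tendsto' hT fun n => (h n).1.2) (le_of_tendsto' hS fun n => (h n).1.1)

lemma prefixRect_congr {α β : ℕ → Fin 3} {n : ℕ} (h : ∀ i < n, α i = β i) :
    prefixRect α n = prefixRect β n := by
  have h1 : prefixSum α n = prefixSum β n :=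
    Finset.sum_congr rfl fun i hi => by rw [h i (Finset.mem_range.1 hi)]
  have h2 : prefixHeight α n = prefixHeight β n :=
    Finset.prod_congr rfl fun i hi => by rw [h i (Finset.mem_range.1 hi)]
  simp only [prefixRect, h1, h2]

/-- A point of `X` lies in a rectangle of every level; by compactness of the space of sequences,
these rectangles may be taken along one sequence. -/
lemma nestedSet_eq_iUnion_fibre : nestedSet = ⋃ α, fibre α := by
  ext p
  simp only [nestedSet, mem_iInter, mem_iUnion, mem_level_iff, fibre_eq_iInter]
  refine ⟨fun h => ?_, fun ⟨α, h⟩ n => ⟨α, h n⟩⟩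
  set A : ℕ → Set (ℕ → Fin 3) := fun n => {α | p ∈ prefixRect α n} with hA
  have hcl : ∀ n, IsClosed (A n) := by
    intro n
    refine isOpen_compl_iff.1 (isOpen_iff_forall_mem_open.2 fun α hα => ?_)
    refine ⟨_, fun β hβ hβA => hα ?_, isOpen_setOf_agree n α, fun _ _ => rfl⟩
    have : p ∈ prefixRect β n := hβA
    rwa [prefixRect_congr hβ] at this
  obtain ⟨α, hα⟩ := IsCompact.nonempty_iInter_of_sequence_nonempty_isCompact_isClosed A
    (fun n α hα => prefixRect_succ_subset α n hα) h (hcl 0).isCompact hcl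
  exact ⟨α, fun n => mem_iInter.1 hα n⟩

/-! ### The effect of the odometer on `ℓ_α` -/

lemma addOne_of_lt {α : ℕ → Fin 3} {k i : ℕ} (h : ∀ j < k, α j = 2) (hi : i < k) :
    addOne α i = 0 := by
  rw [addOne, if_pos fun j hj => h j (hj.trans hi), h i hi]
  rfl

lemma addOne_of_eq {α : ℕ → Fin 3} {k : ℕ} (h : ∀ j < k, α j = 2) : addOne α k = α k + 1 := by
  rw [addOne, if_pos h]

lemma addOne_of_gt {α : ℕ → Fin 3} {k i : ℕ} (hk : α k ≠ 2) (hi : k < i) : addOne α i = α i := by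
  rw [addOne, if_neg fun h => hk (h k hi)]

lemma ell_of_first_zero {α : ℕ → Fin 3} {k : ℕ} (h : ∀ j < k, α j = 2) (hk : α k = 0) :
    ell α = ell (addOne α) + 1 := by
  rw [ell, ell, ← encard_insert_of_notMem (a := k) (by simp [addOne_of_eq h, hk])]
  congr 1
  ext i
  rcases lt_trichotomy i k with hi | rfl | hi
  · simp [addOne_of_lt h hi, h i hi]
  · simp [hk]
  · simp [addOne_of_gt (by simp [hk] : α k ≠ 2) hi, hi.ne']

lemma ell_of_first_one {α : ℕ → Fin 3} {k : ℕ} (h : ∀ j < k, α j = 2) (hk : α k = 1) :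
    ell (addOne α) = ell α + 1 := by
  rw [ell, ell, ← encard_insert_of_notMem (a := k) (by simp [hk])]
  congr 1
  ext i
  rcases lt_trichotomy i k with hi | rfl | hi
  · simp [addOne_of_lt h hi, h i hi]
  · simp [addOne_of_eq h, hk]
  · simp [addOne_of_gt (by simp [hk] : α k ≠ 2) hi, hi.ne']

lemma step_cases (α : ℕ → Fin 3) : (∃ k, (∀ j < k, α j = 2) ∧ α k = 0) ∨
    (∃ k, (∀ j < k, α j = 2) ∧ α k = 1) ∨ ∀ j, α j = 2 := by
  classical
  by_cases hex : ∃ k, α k ≠ 2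
  · have h1 : ∀ j < Nat.find hex, α j = 2 := fun j hj => not_not.1 (Nat.find_min hex hj)
    have h2 := Nat.find_spec hex
    have : ∀ d : Fin 3, d ≠ 2 → d = 0 ∨ d = 1 := by decide
    rcases this _ h2 with h | h
    · exact Or.inl ⟨_, h1, h⟩
    · exact Or.inr (Or.inl ⟨_, h1, h⟩)
  · exact Or.inr (Or.inr fun j => not_not.1 fun hj => hex ⟨j, hj⟩)

lemma height_of_ell_eq_top {α : ℕ → Fin 3} (h : ell α = ⊤) : height α = 0 := by
  rw [height, if_pos h]

lemma fibreMap_zero (α : ℕ → Fin 3) : fibreMap α 0 = 0 := mul_zero _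

/-- If `ℓ_α = ℓ_{α+1} + 1`, the fibre map is multiplication by `3`. -/
lemma step_of_ell_eq_add_one {α : ℕ → Fin 3} (h : ell α = ell (addOne α) + 1) :
    height (addOne α) = 3 * height α ∧ ∀ y ∈ Icc 0 (height α), fibreMap α y = 3 * y := by
  by_cases ht : ell (addOne α) = ⊤
  · rw [ht, top_add] at h
    rw [height_of_ell_eq_top h, height_of_ell_eq_top ht]
    refine ⟨by simp, fun y hy => ?_⟩
    rw [le_antisymm hy.2 hy.1, fibreMap_zero, mul_zero]
  · lift ell (addOne α) to ℕ using ht with n hn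
    have h' : ell α = ((n + 1 : ℕ) : ℕ∞) := by rw [h]; norm_cast
    simp only [height, fibreMap, h', ← hn, ENat.natCast_ne_top, if_false, ENat.toNat_natCast]
    refine ⟨by rw [pow_succ]; field_simp, fun y _ => ?_⟩
    simp

/-- If `ℓ_{α+1} = ℓ_α + 1`, the fibre map is division by `3`. -/
lemma step_of_ell_add_one_eq {α : ℕ → Fin 3} (h : ell (addOne α) = ell α + 1) :
    height (addOne α) = height α / 3 ∧ ∀ y ∈ Icc 0 (height α), fibreMap α y = y / 3 := by
  by_cases ht : ell α = ⊤
  · rw [ht, top_add] at h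
    rw [height_of_ell_eq_top h, height_of_ell_eq_top ht]
    refine ⟨by simp, fun y hy => ?_⟩
    rw [le_antisymm hy.2 hy.1, fibreMap_zero, zero_div]
  · lift ell α to ℕ using ht with n hn
    have h' : ell (addOne α) = ((n + 1 : ℕ) : ℕ∞) := by rw [h]; norm_cast
    simp only [height, fibreMap, h', ← hn, ENat.natCast_ne_top, if_false, ENat.toNat_natCast]
    refine ⟨by rw [pow_succ]; field_simp, fun y _ => ?_⟩
    rw [show ((n : ℤ) - ((n + 1 : ℕ) : ℤ)) = -1 by push_cast; ring, zpow_neg_one]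
    ring

/-- Both fibres over `2^∞` and its successor `0^∞` are points. -/
lemma step_of_forall_eq_two {α : ℕ → Fin 3} (h : ∀ j, α j = 2) :
    height α = 0 ∧ height (addOne α) = 0 := by
  have h' : ∀ j, addOne α j = 0 := fun j => addOne_of_lt (fun i _ => h i) j.lt_succ_self
  constructor <;> refine height_of_ell_eq_top ?_
  · simp [ell, h]
  · simp [ell, h']

/-! ### The homeomorphism `H` of `X` -/

lemma mem_nestedSet_iff {α : ℕ → Fin 3} {y : ℝ} :
    (xCoord α, y) ∈ nestedSet ↔ y ∈ Icc 0 (height α) := by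
  simp only [nestedSet_eq_iUnion_fibre, mem_iUnion, fibre, mem_prod, mem_singleton_iff]
  constructor
  · rintro ⟨β, h1, h2⟩
    rwa [xCoord_injective h1]
  · exact fun h => ⟨α, rfl, h⟩

lemma exists_digits (p : nestedSet) : ∃ α, xCoord α = (p : ℝ × ℝ).1 := by
  obtain ⟨α, h, -⟩ := mem_iUnion.1 (nestedSet_eq_iUnion_fibre.subset p.2)
  exact ⟨α, h.symm⟩

/-- The sequence `α` of a point `(x_α, y)` of `X`. -/
def digits (p : nestedSet) : ℕ → Fin 3 := (exists_digits p).choose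

lemma xCoord_digits (p : nestedSet) : xCoord (digits p) = (p : ℝ × ℝ).1 :=
  (exists_digits p).choose_spec

lemma eq_xCoord_digits (p : nestedSet) : (p : ℝ × ℝ) = (xCoord (digits p), (p : ℝ × ℝ).2) := by
  rw [xCoord_digits]

lemma snd_mem_Icc (p : nestedSet) : (p : ℝ × ℝ).2 ∈ Icc 0 (height (digits p)) :=
  mem_nestedSet_iff.1 (eq_xCoord_digits p ▸ p.2)

lemma digits_eq {p : nestedSet} {α : ℕ → Fin 3} {y : ℝ} (h : (p : ℝ × ℝ) = (xCoord α, y)) :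
    digits p = α := xCoord_injective (by rw [xCoord_digits, h])

lemma continuous_digits : Continuous digits := by
  rw [isClosedEmbedding_xCoord.isInducing.continuous_iff]
  exact (continuous_fst.comp continuous_subtype_val).congr fun p => (xCoord_digits p).symm

lemma fibreMap_mem {α : ℕ → Fin 3} {y : ℝ} (hy : y ∈ Icc 0 (height α)) :
    fibreMap α y ∈ Icc 0 (height (addOne α)) ∧ fibreMap α y ≤ 3 * y := by
  have h0 := hy.1
  have h1 := hy.2
  rcases step_cases α with ⟨k, hk, hk'⟩ | ⟨k, hk, hk'⟩ | h
  · obtain ⟨e1, e2⟩ := step_of_ell_eq_add_one (ell_of_first_zero hk hk')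
    rw [e1, e2 y hy]
    exact ⟨⟨by linarith, by linarith⟩, le_rfl⟩
  · obtain ⟨e1, e2⟩ := step_of_ell_add_one_eq (ell_of_first_one hk hk')
    rw [e1, e2 y hy]
    exact ⟨⟨by linarith, by linarith⟩, by linarith⟩
  · obtain ⟨e1, e2⟩ := step_of_forall_eq_two h
    rw [e1] at h1
    rw [le_antisymm h1 h0, fibreMap_zero, e2]
    simp

/-- The map `(x_α, y) ↦ (x_{α+1}, 3 ^ (ℓ_α - ℓ_{α+1}) y)` on `X`. -/
def stepMap (p : nestedSet) : nestedSet :=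
  ⟨(xCoord (addOne (digits p)), fibreMap (digits p) (p : ℝ × ℝ).2),
    mem_nestedSet_iff.2 (fibreMap_mem (snd_mem_Icc p)).1⟩

lemma stepMap_coe {p : nestedSet} {α : ℕ → Fin 3} {y : ℝ} (h : (p : ℝ × ℝ) = (xCoord α, y)) :
    (stepMap p : ℝ × ℝ) = (xCoord (addOne α), fibreMap α y) := by
  simp only [stepMap, digits_eq h, h]

/-- The factor `3 ^ (ℓ_α - ℓ_{α+1})` depends only on the digits up to the first one different from
`2`, so it is locally constant off `2^∞`; at `2^∞` continuity holds because the ordinates near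
the point `(x_α, 0)` are small and the factor is at most `3`. -/
lemma continuous_stepMap : Continuous stepMap := by
  refine Continuous.subtype_mk (Continuous.prodMk
    (continuous_xCoord.comp (continuous_addOne.comp continuous_digits)) ?_) _
  have hsnd : Continuous fun p : nestedSet => (p : ℝ × ℝ).2 :=
    continuous_snd.comp continuous_subtype_val
  refine continuous_iff_continuousAt.2 fun p => ?_
  have hnhds : ∀ n, ∀ᶠ q in 𝓝 p, ∀ j < n, digits q j = digits p j := fun n =>
    continuous_digits.continuousAt.eventually
      ((isOpen_setOf_agree n (digits p)).mem_nhds fun _ _ => rfl)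
  rcases step_cases (digits p) with ⟨k, hk, hk'⟩ | ⟨k, hk, hk'⟩ | h
  · refine ((continuous_const.mul hsnd).continuousAt (x := p) :
      ContinuousAt (fun q : nestedSet => 3 * (q : ℝ × ℝ).2) p).congr ?_
    filter_upwards [hnhds (k + 1)] with q hq
    exact ((step_of_ell_eq_add_one (ell_of_first_zero
      (fun j hj => (hq j (by omega)).trans (hk j hj)) ((hq k (by omega)).trans hk'))).2 _
      (snd_mem_Icc q)).symm
  · refine ((hsnd.div_const 3).continuousAt (x := p)).congr ?_
    filter_upwards [hnhds (k + 1)] with q hq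
    exact ((step_of_ell_add_one_eq (ell_of_first_one
      (fun j hj => (hq j (by omega)).trans (hk j hj)) ((hq k (by omega)).trans hk'))).2 _
      (snd_mem_Icc q)).symm
  · have hp := snd_mem_Icc p
    rw [(step_of_forall_eq_two h).1] at hp
    have h0 : (p : ℝ × ℝ).2 = 0 := le_antisymm hp.2 hp.1
    rw [ContinuousAt, h0, fibreMap_zero]
    have hlim : Tendsto (fun q : nestedSet => 3 * (q : ℝ × ℝ).2) (𝓝 p) (𝓝 0) := by
      simpa [h0] using (hsnd.tendsto p).const_mul 3
    exact squeeze_zero (fun q => (fibreMap_mem (snd_mem_Icc q)).1.1)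
      (fun q => (fibreMap_mem (snd_mem_Icc q)).2) hlim

lemma exists_fibreMap_eq {α : ℕ → Fin 3} {z : ℝ} (hz : z ∈ Icc 0 (height (addOne α))) :
    ∃ y ∈ Icc 0 (height α), fibreMap α y = z := by
  obtain ⟨h0, h1⟩ := hz
  rcases step_cases α with ⟨k, hk, hk'⟩ | ⟨k, hk, hk'⟩ | h
  · obtain ⟨e1, e2⟩ := step_of_ell_eq_add_one (ell_of_first_zero hk hk')
    have hy : z / 3 ∈ Icc 0 (height α) := ⟨by linarith, by linarith⟩
    exact ⟨z / 3, hy, by rw [e2 _ hy]; ring⟩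
  · obtain ⟨e1, e2⟩ := step_of_ell_add_one_eq (ell_of_first_one hk hk')
    have hy : 3 * z ∈ Icc 0 (height α) := ⟨by linarith, by linarith⟩
    exact ⟨3 * z, hy, by rw [e2 _ hy]; ring⟩
  · rw [(step_of_forall_eq_two h).2] at h1
    exact ⟨0, ⟨le_rfl, height_nonneg α⟩, by rw [fibreMap_zero]; exact le_antisymm h0 h1⟩

lemma stepMap_bijective : Function.Bijective stepMap := by
  constructor
  · intro p q h
    have h' := congrArg (Subtype.val) h
    simp only [stepMap, Prod.mk.injEq] at h'
    have hd := addOne_injective (xCoord_injective h'.1)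
    have h2 := h'.2
    rw [hd] at h2
    have h3 : (p : ℝ × ℝ).2 = (q : ℝ × ℝ).2 :=
      mul_left_cancel₀ (zpow_ne_zero _ (by norm_num)) h2
    exact Subtype.ext (by rw [eq_xCoord_digits p, eq_xCoord_digits q, hd, h3])
  · intro q
    obtain ⟨α, hα⟩ := addOne_surjective (digits q)
    obtain ⟨y, hy, hyq⟩ := exists_fibreMap_eq (hα ▸ snd_mem_Icc q)
    refine ⟨⟨(xCoord α, y), mem_nestedSet_iff.2 hy⟩, Subtype.ext ?_⟩
    rw [stepMap_coe rfl, hα, hyq, ← eq_xCoord_digits]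

lemma isCompact_level (n : ℕ) : IsCompact (level n) := by
  have : level n = ⋃ w ∈ {w : List (Fin 3) | w.length = n}, (wordRect w).toSet := by
    ext p; simp [level]
  rw [this]
  exact (List.finite_length_eq (Fin 3) n).isCompact_biUnion fun w _ =>
    isCompact_Icc.prod isCompact_Icc

lemma isCompact_nestedSet : IsCompact nestedSet :=
  (isCompact_level 0).of_isClosed_subset (isClosed_iInter fun n => (isCompact_level n).isClosed)
    (iInter_subset _ 0)

instance : CompactSpace nestedSet := isCompact_iff_compactSpace.1 isCompact_nestedSet

/-- The homeomorphism `H` of `X`. -/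
def stepHomeo : nestedSet ≃ₜ nestedSet :=
  continuous_stepMap.homeoOfEquivCompactToT2 (f := Equiv.ofBijective _ stepMap_bijective)

lemma stepHomeo_coe {p : nestedSet} {α : ℕ → Fin 3} {y : ℝ} (h : (p : ℝ × ℝ) = (xCoord α, y)) :
    (stepHomeo p : ℝ × ℝ) = (xCoord (addOne α), fibreMap α y) := stepMap_coe h

/-! ### The Cantor set `Y` -/

lemma div_three_mem_cantorSet {y : ℝ} (hy : y ∈ cantorSet) : y / 3 ∈ cantorSet := by
  rw [cantorSet_eq_union_halves]
  exact Or.inl ⟨y, hy, rfl⟩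

lemma three_mul_mem_cantorSet {y : ℝ} (hy : y ∈ cantorSet) (h : y ≤ 1 / 3) :
    3 * y ∈ cantorSet := by
  rw [cantorSet_eq_union_halves] at hy
  rcases hy with ⟨c, hc, rfl⟩ | ⟨c, hc, rfl⟩
  · simpa [mul_div_cancel₀] using hc
  · have := (cantorSet_subset_unitInterval hc).1
    simp only at h
    linarith

lemma div_pow_mem_cantorSet {y : ℝ} (hy : y ∈ cantorSet) (k : ℕ) : y / 3 ^ k ∈ cantorSet := by
  induction k with
  | zero => simpa using hy
  | succ k ih => rw [pow_succ, ← div_div]; exact div_three_mem_cantorSet ih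

lemma pow_mul_mem_cantorSet {y : ℝ} (hy : y ∈ cantorSet) {k : ℕ} (h : y ≤ (3 ^ k)⁻¹) :
    3 ^ k * y ∈ cantorSet := by
  induction k generalizing y with
  | zero => simpa using hy
  | succ k ih =>
    have hk : (1 : ℝ) ≤ 3 ^ k := one_le_pow₀ (by norm_num)
    have h1 : y ≤ (3 ^ k)⁻¹ / 3 := by rwa [pow_succ, mul_inv, ← div_eq_mul_inv] at h
    have h2 : y ≤ 1 / 3 := by
      have := inv_le_one_of_one_le₀ hk
      linarith
    rw [pow_succ, mul_assoc]
    exact ih (three_mul_mem_cantorSet hy h2) (by linarith)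

lemma fibreMap_mem_cantorSet_iff {α : ℕ → Fin 3} {y : ℝ} (hy : y ∈ Icc 0 (height α)) :
    fibreMap α y ∈ cantorSet ↔ y ∈ cantorSet := by
  have h1 := hy.2
  rcases step_cases α with ⟨k, hk, hk'⟩ | ⟨k, hk, hk'⟩ | h
  · obtain ⟨e1, e2⟩ := step_of_ell_eq_add_one (ell_of_first_zero hk hk')
    rw [e2 y hy]
    have h3 := height_le_one (addOne α)
    refine ⟨fun h => ?_, fun h => three_mul_mem_cantorSet h (by linarith)⟩
    simpa using div_three_mem_cantorSet h
  · obtain ⟨e1, e2⟩ := step_of_ell_add_one_eq (ell_of_first_one hk hk')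
    rw [e2 y hy]
    have h3 := height_le_one α
    refine ⟨fun h => ?_, div_three_mem_cantorSet⟩
    simpa [mul_div_cancel₀] using three_mul_mem_cantorSet h (by linarith)
  · rw [(step_of_forall_eq_two h).1] at h1
    rw [le_antisymm h1 hy.1, fibreMap_zero]

lemma mem_cantorPart_iff (p : nestedSet) : p ∈ cantorPart ↔ (p : ℝ × ℝ).2 ∈ cantorSet :=
  ⟨fun h => h.2, fun h => ⟨⟨digits p, xCoord_digits p⟩, h⟩⟩

lemma stepHomeo_mem_cantorPart_iff (p : nestedSet) : p ∈ cantorPart ↔ stepHomeo p ∈ cantorPart := by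
  rw [mem_cantorPart_iff, mem_cantorPart_iff, stepHomeo_coe (eq_xCoord_digits p),
    fibreMap_mem_cantorSet_iff (snd_mem_Icc p)]

lemma stepHomeo_image_cantorPart : stepHomeo '' cantorPart = cantorPart := by
  ext q
  constructor
  · rintro ⟨p, hp, rfl⟩
    exact (stepHomeo_mem_cantorPart_iff p).1 hp
  · intro hq
    refine ⟨stepHomeo.symm q, ?_, by simp⟩
    rw [stepHomeo_mem_cantorPart_iff]
    simpa using hq

/-- The point `(x_α, y)` of `Y`. -/
def cantorPoint (α : ℕ → Fin 3) (y : ℝ) (hy : y ∈ Icc 0 (height α)) (hc : y ∈ cantorSet) :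
    cantorPart :=
  ⟨⟨(xCoord α, y), mem_nestedSet_iff.2 hy⟩, ⟨α, rfl⟩, hc⟩

instance : CompactSpace cantorPart := by
  have : IsClosed cantorPart :=
    (isClosedEmbedding_xCoord.isClosed_range.prod isClosed_cantorSet).preimage
      continuous_subtype_val
  exact isCompact_iff_compactSpace.1 this.isCompact

instance : TotallyDisconnectedSpace cantorPart := by
  have hC : TotallyDisconnectedSpace cantorSet :=
    cantorSetHomeomorphNatToBool.symm.totallyDisconnectedSpace
  let f : cantorPart → (ℕ → Fin 3) × cantorSet := fun p => (digits p, ⟨_, p.2.2⟩)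
  have hf : Continuous f := (continuous_digits.comp continuous_subtype_val).prodMk
    ((continuous_snd.comp (continuous_subtype_val.comp continuous_subtype_val)).subtype_mk _)
  have hinj : Function.Injective f := by
    intro p q h
    simp only [f, Prod.mk.injEq, Subtype.mk.injEq] at h
    exact Subtype.ext (Subtype.ext (by rw [eq_xCoord_digits p, eq_xCoord_digits q, h.1, h.2]))
  exact ⟨isTotallyDisconnected_of_image hf.continuousOn hinj
    (isTotallyDisconnected_of_totallyDisconnectedSpace _)⟩

lemma tendsto_update {A : Type*} [TopologicalSpace A] (z u : ℕ → A) :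
    Tendsto (fun n => Function.update z n (u n)) atTop (𝓝 z) := by
  refine tendsto_pi_nhds.2 fun i => tendsto_const_nhds.congr' ?_
  filter_upwards [eventually_gt_atTop i] with n hn
  rw [Function.update_of_ne hn.ne]

lemma exists_seq_tendsto_cantorSet {c : ℝ} (hc : c ∈ cantorSet) :
    ∃ u : ℕ → ℝ, (∀ n, u n ∈ cantorSet ∧ u n ≠ c) ∧ Tendsto u atTop (𝓝 c) := by
  set e := cantorSetHomeomorphNatToBool
  set z := e ⟨c, hc⟩ with hz
  refine ⟨fun n => e.symm (Function.update z n (!z n)),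
    fun n => ⟨Subtype.coe_prop _, fun h => ?_⟩, ?_⟩
  · have h1 : e.symm (Function.update z n (!z n)) = ⟨c, hc⟩ := Subtype.ext h
    rw [e.symm_apply_eq, ← hz] at h1
    simpa using congrFun h1 n
  · have h1 := (continuous_subtype_val.comp e.symm.continuous).tendsto z
    have h2 := h1.comp (tendsto_update z fun n => !z n)
    simpa [hz, Function.comp_def] using h2

/-- No point of `Y` is isolated: a point `(x_α, 0)` is approached by points of other fibres, and a
point off the horizontal axis by points of its own fibre, which is a Cantor set. -/
lemma cantorPart_nhdsNE_neBot (p : cantorPart) : (𝓝[≠] p).NeBot := by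
  suffices h : ∃ u : ℕ → cantorPart, (∀ n, u n ≠ p) ∧ Tendsto u atTop (𝓝 p) by
    obtain ⟨u, hu, hlim⟩ := h
    exact (tendsto_nhdsWithin_iff.2 ⟨hlim, Eventually.of_forall hu⟩).neBot
  have hp := eq_xCoord_digits p.1
  have hI := snd_mem_Icc p.1
  have hC := p.2.2
  set α := digits p.1
  generalize hy : (p : ℝ × ℝ).2 = y at *
  by_cases h0 : y = 0
  · subst h0
    refine ⟨fun n => cantorPoint (Function.update α n (α n + 1)) 0 ⟨le_rfl, height_nonneg _⟩ hC,
      fun n h => ?_, ?_⟩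
    · have h1 := congrArg (fun q : cantorPart => (q : ℝ × ℝ).1) h
      simp only [cantorPoint, hp] at h1
      have h2 := congrFun (xCoord_injective h1) n
      simp at h2
    · rw [tendsto_subtype_rng, tendsto_subtype_rng, hp]
      exact ((continuous_xCoord.tendsto α).comp
        (tendsto_update α fun n => α n + 1)).prodMk_nhds tendsto_const_nhds
  · have hell : ell α ≠ ⊤ := fun h => h0 (le_antisymm (height_of_ell_eq_top h ▸ hI.2) hI.1)
    have hh : height α = (3 ^ (ell α).toNat)⁻¹ := by rw [height, if_neg hell]
    set k := (ell α).toNat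
    obtain ⟨u, hu, hlim⟩ := exists_seq_tendsto_cantorSet (pow_mul_mem_cantorSet hC (hh ▸ hI.2))
    have h3 : (0 : ℝ) < 3 ^ k := by positivity
    refine ⟨fun n => cantorPoint α (u n / 3 ^ k) ⟨?_, ?_⟩ (div_pow_mem_cantorSet (hu n).1 k),
      fun n h => (hu n).2 ?_, ?_⟩
    · exact div_nonneg (cantorSet_subset_unitInterval (hu n).1).1 h3.le
    · rw [hh, div_le_iff₀ h3, inv_mul_cancel₀ h3.ne']
      exact (cantorSet_subset_unitInterval (hu n).1).2
    · have h1 := congrArg (fun q : cantorPart => (q : ℝ × ℝ).2) h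
      simp only [cantorPoint, hp] at h1
      rw [← h1]
      field_simp
    · rw [tendsto_subtype_rng, tendsto_subtype_rng, hp]
      refine tendsto_const_nhds.prodMk_nhds ?_
      have := hlim.div_const (3 ^ k)
      rwa [mul_div_cancel_left₀ _ h3.ne'] at this

lemma isCantor_cantorPart : IsCantor cantorPart := by
  have : Nonempty cantorPart :=
    ⟨cantorPoint (fun _ => 0) 0 ⟨le_rfl, height_nonneg _⟩ zero_mem_cantorSet⟩
  obtain ⟨e⟩ := nonempty_homeomorph_nat_bool cantorPart_nhdsNE_neBot
  exact ⟨e.trans cantorSetHomeomorphNatToBool.symm⟩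

/-! ### Scrambled pairs of `G` -/

/-- The homeomorphism `G = H|_Y`. -/
def cantorHomeo : cantorPart ≃ₜ cantorPart :=
  stepHomeo.subtype stepHomeo_mem_cantorPart_iff

/-- The exponents of the successive fibre maps telescope. This includes the case `ℓ_α = ∞`, where
`toNat` is `0` along the whole orbit and `y = 0`. -/
lemma cantorHomeo_iterate_coe {p : cantorPart} {α : ℕ → Fin 3} {y : ℝ}
    (h : (p : ℝ × ℝ) = (xCoord α, y)) (n : ℕ) :
    ((cantorHomeo^[n] p : cantorPart) : ℝ × ℝ) = (xCoord (addOne^[n] α),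
      (3 : ℝ) ^ (((ell α).toNat : ℤ) - ((ell (addOne^[n] α)).toNat : ℤ)) * y) := by
  induction n with
  | zero => simpa using h
  | succ n ih =>
    rw [Function.iterate_succ_apply', Function.iterate_succ_apply']
    refine (stepHomeo_coe ih).trans (Prod.ext rfl ?_)
    simp only [fibreMap]
    rw [← mul_assoc, ← zpow_add₀ (by norm_num)]
    congr 2
    ring

lemma dist_iterate_of_same_fibre {p q : cantorPart} {α : ℕ → Fin 3} {y z : ℝ}
    (hp : (p : ℝ × ℝ) = (xCoord α, y)) (hq : (q : ℝ × ℝ) = (xCoord α, z)) (n : ℕ) :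
    dist (cantorHomeo^[n] p) (cantorHomeo^[n] q) =
      (3 : ℝ) ^ (((ell α).toNat : ℤ) - ((ell (addOne^[n] α)).toNat : ℤ)) * |y - z| := by
  rw [Subtype.dist_eq, Subtype.dist_eq, cantorHomeo_iterate_coe hp, cantorHomeo_iterate_coe hq,
    Prod.dist_eq, dist_self, Real.dist_eq, ← mul_sub, abs_mul, abs_of_pos (by positivity)]
  exact max_eq_right (by positivity)

lemma isBoundedUnder_dist_iterate (p q : cantorPart) :
    IsBoundedUnder (· ≤ ·) atTop fun n : ℕ => dist (cantorHomeo^[n] p) (cantorHomeo^[n] q) :=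
  isBoundedUnder_of ⟨Metric.diam (univ : Set cantorPart), fun _ =>
    Metric.dist_le_diam_of_mem isCompact_univ.isBounded (mem_univ _) (mem_univ _)⟩

lemma isBoundedUnder_ge_dist_iterate (p q : cantorPart) :
    IsBoundedUnder (· ≥ ·) atTop fun n : ℕ => dist (cantorHomeo^[n] p) (cantorHomeo^[n] q) :=
  isBoundedUnder_of ⟨0, fun _ => dist_nonneg⟩

lemma ell_of_head_one {α β : ℕ → Fin 3} (h0 : α 0 = 1) (h : ∀ i, α (i + 1) = β i) :
    ell α = ell β := by
  rw [ell, ell, ← Nat.succ_injective.encard_image {i | β i = 0 ∨ β i = 2}]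
  congr 1
  ext i
  cases i <;> simp [h0, h]

lemma ell_of_head_two {α β : ℕ → Fin 3} (h0 : α 0 = 2) (h : ∀ i, α (i + 1) = β i) :
    ell α = ell β + 1 := by
  rw [ell, ell, ← Nat.succ_injective.encard_image {i | β i = 0 ∨ β i = 2},
    ← encard_insert_of_notMem (a := 0) (by simp)]
  congr 1
  ext i
  cases i <;> simp [h0, h]

lemma addOne_zero (α : ℕ → Fin 3) : addOne α 0 = α 0 + 1 := by simp [addOne]

lemma addOne_succ (α : ℕ → Fin 3) (i : ℕ) :
    addOne α (i + 1) = if α 0 = 2 then addOne (fun j => α (j + 1)) i else α (i + 1) := by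
  by_cases h : α 0 = 2
  · have : (∀ j < i + 1, α j = 2) ↔ ∀ j < i, α (j + 1) = 2 :=
      ⟨fun H j hj => H (j + 1) (by omega), fun H j hj => by
        cases j with
        | zero => exact h
        | succ j => exact H j (by omega)⟩
    simp only [addOne, this, h, if_true]
  · rw [if_neg h, addOne, if_neg fun H => h (H 0 (by omega))]

/-- Three steps of the odometer advance the shifted sequence by one step. -/
lemma addOne_three (α : ℕ → Fin 3) :
    addOne^[3] α 0 = α 0 ∧ ∀ i, addOne^[3] α (i + 1) = addOne (fun j => α (j + 1)) i := by
  have h3 : ∀ d : Fin 3, d = 0 ∨ d = 1 ∨ d = 2 := by decide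
  simp only [Function.iterate_succ_apply', Function.iterate_zero, id]
  refine ⟨?_, fun i => ?_⟩
  · simp only [addOne_zero]
    generalize α 0 = d
    revert d
    decide
  · rcases h3 (α 0) with h | h | h <;> simp [addOne_zero, addOne_succ, h]

lemma addOne_three_mul (α : ℕ → Fin 3) (n : ℕ) :
    addOne^[3 * n] α 0 = α 0 ∧
      ∀ i, addOne^[3 * n] α (i + 1) = addOne^[n] (fun j => α (j + 1)) i := by
  induction n with
  | zero => simp
  | succ n ih =>
    rw [Nat.mul_succ, add_comm, Function.iterate_add_apply]
    obtain ⟨h1, h2⟩ := addOne_three (addOne^[3 * n] α)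
    refine ⟨h1.trans ih.1, fun i => ?_⟩
    rw [h2, funext ih.2, Function.iterate_succ_apply']

/-- `1^∞ + 3 ^ k = 1^k 2 1^∞`. -/
lemma ell_ones_add_pow (k : ℕ) : ell (addOne^[3 ^ k] fun _ => 1) = 1 := by
  induction k with
  | zero =>
    have h : ell (fun _ : ℕ => (1 : Fin 3)) = 0 := by simp [ell]
    have := ell_of_head_two (α := addOne fun _ => 1) (β := fun _ => 1)
      (by rw [addOne_zero]; rfl) (fun i => by simp [addOne_succ])
    simpa [h] using this
  | succ k ih =>
    obtain ⟨h1, h2⟩ := addOne_three_mul (fun _ => 1) (3 ^ k)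
    rw [pow_succ', ell_of_head_one h1 h2, ih]

/-- For `n = (3 ^ k - 1) / 2` one has `1^∞ + n = 2^k 1^∞`. -/
lemma exists_ell_ones_add (k : ℕ) : ∃ n, k ≤ n ∧ ell (addOne^[n] fun _ => 1) = k := by
  induction k with
  | zero => exact ⟨0, le_rfl, by simp [ell]⟩
  | succ k ih =>
    obtain ⟨n, hkn, hn⟩ := ih
    refine ⟨3 * n + 1, by omega, ?_⟩
    obtain ⟨h1, h2⟩ := addOne_three_mul (fun _ => 1) n
    rw [Function.iterate_succ_apply', ell_of_head_two (β := addOne^[n] fun _ => 1), hn]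
    · norm_cast
    · rw [addOne_zero, h1]; rfl
    · intro i
      rw [addOne_succ, h1, if_neg (by decide), h2]

/-- Distinct points of the fibre over `1^∞` form a scrambled pair: their distance is multiplied by
`3 ^ (-k)` at time `(3 ^ k - 1) / 2` and by `1 / 3` at time `3 ^ k`. -/
lemma mem_LY_of_fibre_ones {p q : cantorPart} {y z : ℝ}
    (hp : (p : ℝ × ℝ) = (xCoord fun _ => 1, y)) (hq : (q : ℝ × ℝ) = (xCoord fun _ => 1, z))
    (hne : y ≠ z) : (p, q) ∈ LY cantorHomeo := by
  have hd := dist_iterate_of_same_fibre hp hq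
  have hell : ell (fun _ : ℕ => (1 : Fin 3)) = 0 := by simp [ell]
  have hpos : 0 < |y - z| := abs_pos.2 (sub_ne_zero.2 hne)
  constructor
  · refine le_antisymm (le_of_forall_pos_le_add fun ε hε => ?_)
      (le_liminf_of_le (isBoundedUnder_dist_iterate p q).isCoboundedUnder_ge
        (Eventually.of_forall fun _ => dist_nonneg))
    refine liminf_le_of_frequently_le (frequently_atTop.2 fun N => ?_)
      (isBoundedUnder_ge_dist_iterate p q)
    have hlim : Tendsto (fun k : ℕ => (1 / 3 : ℝ) ^ k * |y - z|) atTop (𝓝 0) := by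
      simpa using (tendsto_pow_atTop_nhds_zero_of_lt_one (r := (1 / 3 : ℝ)) (by norm_num)
        (by norm_num)).mul_const |y - z|
    obtain ⟨k, hk, hkN⟩ := ((hlim.eventually_le_const hε).and (eventually_ge_atTop N)).exists
    obtain ⟨n, hkn, hn⟩ := exists_ell_ones_add k
    refine ⟨n, hkN.trans hkn, ?_⟩
    simp only [hd, hn, hell]
    simpa using hk
  · have : (1 / 3 : ℝ) * |y - z| ≤
        limsup (fun n : ℕ => dist (cantorHomeo^[n] p) (cantorHomeo^[n] q)) atTop := by
      refine le_limsup_of_frequently_le (frequently_atTop.2 fun N => ?_)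
        (isBoundedUnder_dist_iterate p q)
      refine ⟨3 ^ N, (Nat.lt_pow_self (by norm_num)).le, ?_⟩
      simp [hd, ell_ones_add_pow, hell]
    exact lt_of_lt_of_le (by positivity) this

lemma not_countable_cantorSet : ¬ cantorSet.Countable := by
  intro h
  have : Countable cantorSet := h.to_subtype
  have : Countable (ℕ → Bool) := cantorSetHomeomorphNatToBool.symm.injective.countable
  obtain ⟨f, hf⟩ := exists_surjective_nat (ℕ → Bool)
  obtain ⟨n, hn⟩ := hf fun i => !f i i
  simpa using congrFun hn n

lemma liYorkeChaotic_cantorHomeo : LiYorkeChaotic cantorHomeo := by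
  refine ⟨{p | (p : ℝ × ℝ).1 = xCoord fun _ => 1}, fun h => not_countable_cantorSet ?_, ?_⟩
  · refine (h.image fun p : cantorPart => (p : ℝ × ℝ).2).mono fun c hc => ?_
    have hI : c ∈ Icc 0 (height fun _ => 1) := by
      simpa [height, ell] using cantorSet_subset_unitInterval hc
    exact ⟨cantorPoint (fun _ => 1) c hI hc, rfl, rfl⟩
  · intro p hp q hq hne
    refine mem_LY_of_fibre_ones (Prod.ext hp rfl) (Prod.ext hq rfl) fun h => hne ?_
    exact Subtype.ext (Subtype.ext (Prod.ext (hp.trans hq.symm) h))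

/-- Proximal points lie in the same fibre, because the odometer keeps distinct abscissas apart. -/
lemma digits_eq_of_mem_Prox {p q : cantorPart} (h : (p, q) ∈ Prox cantorHomeo) :
    digits p = digits q := by
  by_contra hne
  obtain ⟨m, hm, hm'⟩ := exists_first_difference hne
  have hle : ∀ n, (1 / 5 : ℝ) ^ (m + 1) ≤ dist (cantorHomeo^[n] p) (cantorHomeo^[n] q) := by
    intro n
    rw [Subtype.dist_eq, Subtype.dist_eq, cantorHomeo_iterate_coe (eq_xCoord_digits p.1),
      cantorHomeo_iterate_coe (eq_xCoord_digits q.1), Prod.dist_eq, Real.dist_eq]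
    exact (le_abs_xCoord_sub (addOne_iterate_agree hm n) (addOne_iterate_differ hm hm' n)).trans
      (le_max_left _ _)
  have h1 : (1 / 5 : ℝ) ^ (m + 1) ≤ 0 := by
    rw [← show _ = (0 : ℝ) from h]
    exact le_liminf_of_le (isBoundedUnder_dist_iterate p q).isCoboundedUnder_ge
      (Eventually.of_forall hle)
  exact absurd h1 (not_le.2 (by positivity))

/-- An `ε`-scrambled set lies in one fibre, over `α` say. Distances in this fibre never grow by a
factor larger than `3 ^ ℓ_α`, so the points of the set are uniformly separated. -/
lemma not_liYorkeEpsChaotic_cantorHomeo {ε : ℝ} (hε : 0 < ε) :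
    ¬ LiYorkeEpsChaotic cantorHomeo ε := by
  rintro ⟨S, hS, hscr⟩
  obtain ⟨p₀, hp₀⟩ : S.Nonempty := nonempty_iff_ne_empty.2 fun h => hS (h ▸ countable_empty)
  set α := digits p₀
  have hα : ∀ p ∈ S, (p : ℝ × ℝ) = (xCoord α, (p : ℝ × ℝ).2) := by
    intro p hp
    by_cases h : p = p₀
    · rw [h]; exact eq_xCoord_digits p₀.1
    · rw [show α = digits p from (digits_eq_of_mem_Prox (hscr p hp p₀ hp₀ h).1).symm]
      exact eq_xCoord_digits p.1
  -- if `ℓ_α = ∞`, then `L = 1`, which is harmless because the fibre is a single point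
  set L : ℝ := 3 ^ (ell α).toNat with hL
  have hLpos : 0 < L := by positivity
  have hsep : ∀ p ∈ S, ∀ q ∈ S, p ≠ q → ε / L < |(p : ℝ × ℝ).2 - (q : ℝ × ℝ).2| := by
    intro p hp q hq hne
    obtain ⟨n, hn⟩ := (frequently_lt_of_lt_limsup
      (isBoundedUnder_ge_dist_iterate p q).isCoboundedUnder_le (hscr p hp q hq hne).2).exists
    rw [div_lt_iff₀' hLpos]
    refine hn.trans_le ?_
    rw [dist_iterate_of_same_fibre (hα p hp) (hα q hq), hL, ← zpow_natCast]
    gcongr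
    · norm_num
    · omega
  -- cells of side `ε / L` on the vertical axis contain at most one ordinate each
  refine hS (MapsTo.countable_of_injOn (f := fun p : cantorPart => ⌊(p : ℝ × ℝ).2 / (ε / L)⌋)
    (mapsTo_univ _ _) (fun p hp q hq h => ?_) countable_univ)
  by_contra hne
  have h1 := Int.abs_sub_lt_one_of_floor_eq_floor h
  rw [← sub_div, abs_div, abs_of_pos (show 0 < ε / L by positivity),
    div_lt_one (by positivity)] at h1
  exact absurd (hsep p hp q hq hne) h1.not_gt

end LiYorke

end

theorem mainTheorem7 :
    LiYorke.nestedSet = ⋃ α : ℕ → Fin 3, LiYorke.fibre α ∧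
    ∃ H : LiYorke.nestedSet ≃ₜ LiYorke.nestedSet,
      (∀ (α : ℕ → Fin 3) (y : ℝ) (p : LiYorke.nestedSet),
        (p : ℝ × ℝ) = (LiYorke.xCoord α, y) →
        (H p : ℝ × ℝ) = (LiYorke.xCoord (LiYorke.addOne α), LiYorke.fibreMap α y)) ∧
      H '' LiYorke.cantorPart = LiYorke.cantorPart ∧
      LiYorke.IsCantor LiYorke.cantorPart ∧
      ∃ G : LiYorke.cantorPart ≃ₜ LiYorke.cantorPart,
        (∀ p : LiYorke.cantorPart, (G p : LiYorke.nestedSet) = H p) ∧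
        LiYorke.LiYorkeChaotic G ∧
        ∀ ε : ℝ, 0 < ε → ¬ LiYorke.LiYorkeEpsChaotic G ε :=
  ⟨LiYorke.nestedSet_eq_iUnion_fibre, LiYorke.stepHomeo, fun _ _ _ h => LiYorke.stepHomeo_coe h,
    LiYorke.stepHomeo_image_cantorPart, LiYorke.isCantor_cantorPart, LiYorke.cantorHomeo,
    fun _ => rfl, LiYorke.liYorkeChaotic_cantorHomeo,
    fun _ hε => LiYorke.not_liYorkeEpsChaotic_cantorHomeo hε⟩
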